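/- **Conventions.** All vector spaces are over $\mathbb{C}$, and $\binom{n}{i}=n(n-1)\cdots(n-i+1)/i!$ for $n\in\mathbb{Z}$, $i\ge 0$. For a linear map $Y_W:V\otimes W\to W((x))$, $u\otimes w\mapsto Y_W(u,x)w$, write $u_n=\mathrm{Res}_x\,x^nY_W(u,x)$, i.e. $Y_W(u,x)w=\sum_{n\in\mathbb{Z}}u_nw\,x^{-n-1}$. A vertex algebra is a triple $(V,Y,\mathbf 1)$ with $Y:V\otimes V\to V((x))$ linear, $Y(\mathbf 1,x)=1_V$, $Y(v,x)\mathbf 1\in V[[x]]$ with constant term $v$, and the Jacobi identity. A module for $V$ is a vector space $W$ with a linear map $Y_W:V\otimes W\to W((x))$ such that $Y_W(\mathbf 1,x)=1_W$ and the Jacobi identity $$x_0^{-1}\delta\!\left(\tfrac{x_1-x_2}{x_0}\right)Y_W(u,x_1)Y_W(v,x_2)w-x_0^{-1}\delta\!\left(\tfrac{x_2-x_1}{-x_0}\right)Y_W(v,x_2)Y_W(u,x_1)w=x_2^{-1}\delta\!\left(\tfrac{x_1-x_0}{x_2}\right)Y_W(Y(u,x_0)v,x_2)w$$ holds. A $\mathbb{Z}$-graded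 vertex algebra is a vertex algebra $V=\coprod_{n\in\mathbb{Z}}V_{(n)}$ such that $[d,Y(u,x)]=x\frac{d}{dx}Y(u,x)+Y(du,x)$ for $u\in V$, where $du=nu$ for $u\in V_{(n)}$. An $\mathbb{N}$-gradable weak $V$-module is a module $W=\coprod_{n\in\mathbb{N}}W_{(n)}$ for the vertex algebra $V$ such that $u_n$ maps $W_{(d)}$ to $W_{(d+m-n-1)}$ for all $u\in V_{(m)}$, $n\in\mathbb{Z}$, $d\in\mathbb{N}$, where $W_{(j)}=0$ for $j<0$. **Theorem 3.2.** Let $V$ be a $\mathbb{Z}$-graded vertex algebra, $W=\coprod_{n\in\mathbb{N}}W_{(n)}$ an $\mathbb{N}$-graded vector space and $Y_W:V\otimes W\to W((x))$ a linear map such that $u_n$ maps $W_{(d)}$ to $W_{(d+m-n-1)}$ for all $u\in V_{(m)}$, $n\in\mathbb{Z}$, $d\in\mathbb{N}$ (with $W_{(j)}=0$ for $j<0$), and $Y_W(\mathbf 1,x)=1_W$. Assume that for all homogeneous $u,v\in V$ and $w\in W$ (in particular, it suffices that this holds for all $u,v\in V$ and $w\in W$) there exist $k,l\in\mathbb{Z}$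 such that 1. $v_nw=0$ for $n\ge k$ and $u_nw=0$ for $n\ge l$; 2. for all $p,q\in\mathbb{Z}$ with $q<k$, $$\mathrm{Res}_{x_1}\mathrm{Res}_{x_2}\,x_1^px_2^q\,Y_W(u,x_1)Y_W(v,x_2)w=\mathrm{Res}_{x_0}\mathrm{Res}_{x_2}\Big(\sum_{i=0}^{k-q-1}\binom{p-l}{i}x_0^{p-l-i}x_2^i\Big)x_2^q(x_0+x_2)^l\,Y_W(Y(u,x_0)v,x_2)w;$$ 3. for all $p,q,i\in\mathbb{Z}$ with $i\ge k-q$, $$\mathrm{Res}_{x_0}\mathrm{Res}_{x_2}\,x_0^{p-l-i}x_2^{q+i}(x_0+x_2)^l\,Y_W(Y(u,x_0)v,x_2)w=0.$$ (If $l<0$, then $(x_0+x_2)^l$ is expanded in nonnegative powers of $x_0$, so that the products above exist.) Then $(W,Y_W)$ is an $\mathbb{N}$-gradable weak $V$-module. -/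

import Mathlib

namespace FormalVOA

/-! ### Vertex operators, modes and the Jacobi identity -/

section Basic

variable {V W : Type*} [AddCommGroup V] [Module ℂ V] [AddCommGroup W] [Module ℂ W]

/-- A linear map `V ⊗ W → W((x))`, `u ⊗ w ↦ Y(u, x) w`, in curried form
(`VertexOperator ℂ W` is Mathlib's type of linear maps `W → W((x))`). The lower truncation
property of `Y(u, x) w` is part of the type. -/
abbrev VertexMap (V W : Type*) [AddCommGroup V] [Module ℂ V] [AddCommGroup W] [Module ℂ W] :=
  V →ₗ[ℂ] VertexOperator ℂ W

/-- The component `u_n = Res_x xⁿ Y(u, x)`, the coefficient of `x^(-n-1)`. -/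
noncomputable abbrev mode (Y : VertexMap V W) (u : V) (n : ℤ) : W →ₗ[ℂ] W :=
  VertexOperator.ncoeff (Y u) n

/-- `Y(𝟏, x) = 1_W`: the series `Y(𝟏, x) w` is the constant series `w`. -/
def VacuumProperty (vac : V) (Y : VertexMap V W) : Prop :=
  ∀ w : W, Y vac w = HahnModule.of ℂ (HahnSeries.single (0 : ℤ) w)

/-- The Jacobi identity
`x₀⁻¹δ((x₁-x₂)/x₀) Y_W(u,x₁)Y_W(v,x₂)w - x₀⁻¹δ((x₂-x₁)/(-x₀)) Y_W(v,x₂)Y_W(u,x₁)w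
  = x₂⁻¹δ((x₁-x₀)/x₂) Y_W(Y(u,x₀)v,x₂)w`,
written out in components: `Res_{x₀} Res_{x₁} Res_{x₂} x₀ʳ x₁ᵖ x₂^q` of both sides, for all
integers `p, q, r`. All three sums have finitely many non-zero terms by lower truncation. -/
def JacobiIdentity (Y : VertexMap V V) (YW : VertexMap V W) : Prop :=
  ∀ (u v : V) (w : W) (p q r : ℤ),
    (∑ᶠ i : ℕ, ((-1 : ℤ) ^ i * Ring.choose r i) •
        mode YW u (p + r - i) (mode YW v (q + i) w)) -
      (∑ᶠ i : ℕ, (((r + i).negOnePow : ℤ) * Ring.choose r i) •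
        mode YW v (q + r - i) (mode YW u (p + i) w)) =
      ∑ᶠ i : ℕ, (Ring.choose p i) • mode YW (mode Y u (r + i) v) (p + q - i) w

end Basic

/-- A vertex algebra `(V, Y, 𝟏)` over `ℂ`. -/
structure VertexAlgebra (V : Type*) [AddCommGroup V] [Module ℂ V] where
  /-- The vertex operator map `V ⊗ V → V((x))`. -/
  Y : VertexMap V V
  /-- The vacuum vector. -/
  vac : V
  vacuum : VacuumProperty vac Y
  /-- `Y(v, x)𝟏` has no negative powers of `x`. -/
  creation_regular : ∀ (v : V) (n : ℤ), 0 ≤ n → mode Y v n vac = 0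
  /-- The constant term of `Y(v, x)𝟏` is `v`. -/
  creation_const : ∀ v : V, mode Y v (-1) vac = v
  jacobi : JacobiIdentity Y Y

/-- `(W, Y_W)` is a module for `V` viewed as a vertex algebra (no grading involved). -/
structure IsModule {V W : Type*} [AddCommGroup V] [Module ℂ V] [AddCommGroup W] [Module ℂ W]
    (A : VertexAlgebra V) (YW : VertexMap V W) : Prop where
  vacuum : VacuumProperty A.vac YW
  jacobi : JacobiIdentity A.Y YW

/-! ### Gradings -/

section Gradings

variable {V W : Type*} [AddCommGroup V] [Module ℂ V] [AddCommGroup W] [Module ℂ W]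

theorem coeLinearMap_bijective (gV : ℤ → Submodule ℂ V) (h : DirectSum.IsInternal gV) :
    Function.Bijective (DirectSum.coeLinearMap gV) := h

/-- The degree operator `d` of a grading `V = ∐ V_(n)`: `d u = n u` for `u ∈ V_(n)`. -/
noncomputable def degreeOperator (gV : ℤ → Submodule ℂ V) (h : DirectSum.IsInternal gV) :
    V →ₗ[ℂ] V :=
  (DirectSum.toModule ℂ ℤ V fun n => (n : ℂ) • (gV n).subtype) ∘ₗ
    (LinearEquiv.ofBijective (DirectSum.coeLinearMap gV) (coeLinearMap_bijective gV h)).symm.toLinearMap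

theorem degreeOperator_apply (gV : ℤ → Submodule ℂ V) (h : DirectSum.IsInternal gV)
    (n : ℤ) (u : V) (hu : u ∈ gV n) : degreeOperator gV h u = (n : ℂ) • u := by
  have key : (LinearEquiv.ofBijective (DirectSum.coeLinearMap gV) (coeLinearMap_bijective gV h)).symm u =
      DirectSum.lof ℂ ℤ (fun i => gV i) n ⟨u, hu⟩ := by
    rw [LinearEquiv.symm_apply_eq]
    simp
  simp [degreeOperator, key]

/-- `V = ∐_{n ∈ ℤ} V_(n)` is a `ℤ`-graded vertex algebra:
`[d, Y(u, x)] = x (d/dx) Y(u, x) + Y(d u, x)`, compared at each power `x^(-n-1)`. -/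
structure IsZGraded (A : VertexAlgebra V) (gV : ℤ → Submodule ℂ V) : Prop where
  internal : DirectSum.IsInternal gV
  bracket : ∀ (u v : V) (n : ℤ),
    degreeOperator gV internal (mode A.Y u n v) - mode A.Y u n (degreeOperator gV internal v) =
      ((-n - 1 : ℤ) : ℂ) • mode A.Y u n v + mode A.Y (degreeOperator gV internal u) n v

/-- An `ℕ`-grading regarded as a `ℤ`-grading, with `W_(j) = 0` for `j < 0`. -/
def extendGrading (gW : ℕ → Submodule ℂ W) : ℤ → Submodule ℂ W
  | Int.ofNat n => gW n
  | Int.negSucc _ => ⊥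

/-- For `u ∈ V_(m)`, the component `u_n` maps `W_(d)` to `W_(d+m-n-1)`. -/
def DegreeCompatible (gV : ℤ → Submodule ℂ V) (gW : ℕ → Submodule ℂ W)
    (YW : VertexMap V W) : Prop :=
  ∀ (m n : ℤ) (d : ℕ) (u : V) (w : W), u ∈ gV m → w ∈ gW d →
    mode YW u n w ∈ extendGrading gW (d + m - n - 1)

/-- `W = ∐_{n ∈ ℕ} W_(n)` with `Y_W` is an `ℕ`-gradable weak `V`-module. -/
structure IsNGradableWeakModule (A : VertexAlgebra V) (gV : ℤ → Submodule ℂ V)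
    (gW : ℕ → Submodule ℂ W) (YW : VertexMap V W) : Prop where
  isModule : IsModule A YW
  internal : DirectSum.IsInternal gW
  degree : DegreeCompatible gV gW YW

end Gradings

/-! ### Formal series in two variables and the residue formulas -/

section Residues

variable {V W : Type*} [AddCommGroup V] [Module ℂ V] [AddCommGroup W] [Module ℂ W]

/-- `W[[y^{±1}, z^{±1}]]`: the value at `(a, b)` is the coefficient of `y^a z^b`. -/
abbrev Formal2 (W : Type*) := ℤ → ℤ → W

/-- `Res_y Res_z`. -/
def res2 (F : Formal2 W) : W := F (-1) (-1)

/-- Multiplication by `y^m z^n`. -/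
def mulMonomial (m n : ℤ) (F : Formal2 W) : Formal2 W :=
  fun a b => F (a - m) (b - n)

/-- Multiplication by `(y + z)^l`. For `l ≥ 0` this is multiplication by a polynomial. For `l < 0`
the power is expanded in non-negative powers of `y`, so that its product with a series such
as `Y_W(Y(u, y)v, z)w`, in which the powers of `y` are bounded below, exists. -/
noncomputable def mulAddPow (l : ℤ) (F : Formal2 W) : Formal2 W :=
  fun a b => ∑ᶠ j : ℕ, Ring.choose l j • F (a - j) (b - (l - j))

/-- Multiplication by the Laurent polynomial `∑_{i=0}^{N-1} binom(n, i) y^(n-i) z^i`. -/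
noncomputable def mulTruncatedBinomial (n : ℤ) (N : ℕ) (F : Formal2 W) : Formal2 W :=
  fun a b => ∑ i ∈ Finset.range N, Ring.choose n i • F (a - (n - i)) (b - i)

/-- `Y_W(u, x₁) Y_W(v, x₂) w`. -/
noncomputable def productSeries (YW : VertexMap V W) (u v : V) (w : W) : Formal2 W :=
  fun a b => HVertexOperator.coeff (YW u) a (HVertexOperator.coeff (YW v) b w)

/-- `Y_W(Y(u, x₀) v, x₂) w`. -/
noncomputable def iterateSeries (Y : VertexMap V V) (YW : VertexMap V W) (u v : V) (w : W) :
    Formal2 W :=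
  fun a b => HVertexOperator.coeff (YW (HVertexOperator.coeff (Y u) a v)) b w

/-- The residue formula for products:
`Res_{x₁} Res_{x₂} x₁ᵖ x₂^q Y_W(u, x₁) Y_W(v, x₂) w
  = Res_{x₀} Res_{x₂} p(x₀, x₂) x₂^q (x₀ + x₂)^l Y_W(Y(u, x₀)v, x₂) w`
with `p(x₀, x₂) = ∑_{i=0}^{k-q-1} binom(p-l, i) x₀^(p-l-i) x₂^i`. -/
def ProductResidueFormula (Y : VertexMap V V) (YW : VertexMap V W) (u v : V) (w : W)
    (k l p q : ℤ) : Prop :=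
  res2 (mulMonomial p q (productSeries YW u v w)) =
    res2 (mulTruncatedBinomial (p - l) (k - q).toNat
      (mulMonomial 0 q (mulAddPow l (iterateSeries Y YW u v w))))

/-- The residue formula for iterates:
`Res_{x₀} Res_{x₂} x₀^(p-l-i) x₂^(q+i) (x₀ + x₂)^l Y_W(Y(u, x₀)v, x₂) w = 0`. -/
def IterateResidueFormula (Y : VertexMap V V) (YW : VertexMap V W) (u v : V) (w : W)
    (l p q i : ℤ) : Prop :=
  res2 (mulMonomial (p - l - i) (q + i) (mulAddPow l (iterateSeries Y YW u v w))) = 0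

end Residues

end FormalVOA

/-!
Every identity between the modes of `Y_W(u, x₁)Y_W(v, x₂)w`, `Y_W(v, x₂)Y_W(u, x₁)w` and
`Y_W(Y(u, x₀)v, x₂)w` in the Jacobi identity takes place in a single total degree `M = p + q + r`.
There a series in two variables becomes a series in the one variable `z = x₀ / x₂`, and
`x₁ = x₀ + x₂` becomes `1 + z`. The residue formulas say that, in each total degree, product and
iterate are the expansions at infinity and at `0` of one `W`-valued rational function `F` with
poles only at `0`, `-1` and infinity (`WeaklyAssociative.of_residueFormulas`). This property is
additive in `u`, `v`, `w`, so it passes from homogeneous to arbitrary vectors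
(`WeaklyAssociative.of_homogeneous`), although `k` and `l` depend on the vectors.

Taking `v = 𝟏` gives `Y_W(Y(a, x₀)𝟏, x₂) = Y_W(a, x₂ + x₀)` (`mode_mode_vac`), since `F` is
determined by its expansion at infinity. Together with skew-symmetry in `V`, this identifies the
rational function of the pair `(v, u)`, pulled back along `z ↦ -z / (1 + z)`, with that of `(u, v)`,
since a rational function is also determined by its expansion at `0`. The pullback exchanges
infinity and `-1`, so the opposite product consists of the residues of `F` at `-1`
(`WeaklyAssociative.exists_rationalForm`). The Jacobi identity is then the residue theorem for
`z^r (1 + z)^p F`, where the powers of `z` and `1 + z` are expanded by Vandermonde's identity.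
-/

namespace FormalVOA

/-! ### Binomial coefficients with integer lower index -/

/-- The sign `(-1)ᵏ` as an integer. -/
abbrev sgn (k : ℤ) : ℤ := (k.negOnePow : ℤ)

theorem sgn_add (a b : ℤ) : sgn (a + b) = sgn a * sgn b := by
  simp [sgn, Int.negOnePow_add]

theorem sgn_congr {a b : ℤ} (h : Even (a - b)) : sgn a = sgn b := by
  simp only [sgn, (Int.negOnePow_eq_iff a b).2 h]

theorem sgn_mul_self (a : ℤ) : sgn a * sgn a = 1 := by
  rw [← sgn_add, sgn, Int.negOnePow_even _ ⟨a, rfl⟩, Units.val_one]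

theorem sgn_one : sgn 1 = -1 := by simp [sgn]

/-- The binomial coefficient `binom(n, k)` for integers `n, k`, equal to `0` for `k < 0`. -/
noncomputable def zchoose (n k : ℤ) : ℤ := if 0 ≤ k then Ring.choose n k.toNat else 0

theorem zchoose_of_neg (n : ℤ) {k : ℤ} (hk : k < 0) : zchoose n k = 0 := by
  simp [zchoose, hk]

theorem zchoose_natCast (n : ℤ) (k : ℕ) : zchoose n k = Ring.choose n k := by
  simp [zchoose]

theorem finite_support_mul_zchoose (c n : ℕ → ℤ) (k : ℤ) :
    (Function.support fun i : ℕ => c i * zchoose (n i) (k - i)).Finite := by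
  refine (Set.finite_Iio (k.toNat + 1)).subset fun i hi => ?_
  by_contra h
  simp only [Set.mem_Iio] at h
  exact hi (by simp only [zchoose_of_neg (n i) (show k - (i : ℤ) < 0 by omega), mul_zero])

/-- Vandermonde's identity `∑ᵢ binom(p, i) binom(n, k - i) = binom(n + p, k)`. -/
theorem finsum_choose_mul_zchoose (p n k : ℤ) :
    ∑ᶠ i : ℕ, Ring.choose p i * zchoose n (k - i) = zchoose (n + p) k := by
  rcases lt_or_ge k 0 with hk | hk
  · rw [zchoose_of_neg _ hk]
    refine (finsum_congr fun i => ?_).trans finsum_zero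
    rw [zchoose_of_neg _ (by omega), mul_zero]
  · lift k to ℕ using hk
    rw [finsum_eq_sum_of_support_subset (s := Finset.range (k + 1)), zchoose_natCast, add_comm n p,
      Ring.add_choose_eq k (Commute.all p n),
      Finset.Nat.sum_antidiagonal_eq_sum_range_succ
        (fun i j => Ring.choose p i * Ring.choose n j)]
    · refine Finset.sum_congr rfl fun i hi => ?_
      rw [Finset.mem_range] at hi
      rw [← zchoose_natCast n, Nat.cast_sub (by omega)]
    · intro i hi
      by_contra h
      simp only [Finset.coe_range, Set.mem_Iio] at h
      exact hi (by simp only [zchoose_of_neg n (show (k : ℤ) - (i : ℤ) < 0 by omega), mul_zero])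

theorem zchoose_upper_neg (n k : ℤ) : zchoose n k = sgn k * zchoose (k - n - 1) k := by
  rcases lt_or_ge k 0 with hk | hk
  · simp [zchoose_of_neg _ hk]
  · lift k to ℕ using hk
    rw [zchoose_natCast, zchoose_natCast]
    have := Ring.choose_neg (-n) k
    rw [neg_neg] at this
    rw [this, Units.smul_def, smul_eq_mul]
    congr 2
    ring

theorem zchoose_symm {n : ℤ} (hn : 0 ≤ n) (k : ℤ) : zchoose n k = zchoose n (n - k) := by
  lift n to ℕ using hn
  have key : ∀ i : ℕ, n < i → zchoose n i = 0 := fun i hi => by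
    rw [zchoose_natCast, Ring.choose_natCast, Nat.choose_eq_zero_of_lt hi, Nat.cast_zero]
  rcases lt_or_ge k 0 with hk | hk
  · rw [zchoose_of_neg _ hk]
    have := key (n - k).toNat (by omega)
    rw [Int.toNat_of_nonneg (by omega)] at this
    exact this.symm
  · lift k to ℕ using hk
    rcases lt_or_ge n k with h | h
    · rw [key k h, zchoose_of_neg _ (by omega)]
    · rw [← Nat.cast_sub h, zchoose_natCast, zchoose_natCast, Ring.choose_natCast,
        Ring.choose_natCast, Nat.choose_symm h]

/-! ### Residues of `z^α (1 + z)^β` -/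

/-- The residue of `z^α (1 + z)^β` at `z = 0`. -/
noncomputable def resZeroCoeff (α β : ℤ) : ℤ := zchoose β (-1 - α)

/-- The coefficient of `z⁻¹` in the expansion of `z^α (1 + z)^β` in descending powers of `z`:
minus the residue at infinity. -/
noncomputable def resInftyCoeff (α β : ℤ) : ℤ := zchoose β (α + β + 1)

/-- The residue of `z^α (1 + z)^β` at `z = -1`. -/
noncomputable def resNegOneCoeff (α β : ℤ) : ℤ := sgn (α + β + 1) * zchoose α (-1 - β)

theorem resInftyCoeff_eq (α β : ℤ) :
    resInftyCoeff α β = sgn (α + β + 1) * zchoose α (α + β + 1) := by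
  rw [resInftyCoeff, zchoose_upper_neg]
  congr 2
  ring

/-- The residue theorem for `z^α (1 + z)^β`. -/
theorem resInftyCoeff_eq_add (α β : ℤ) :
    resInftyCoeff α β = resZeroCoeff α β + resNegOneCoeff α β := by
  rcases lt_or_ge β 0 with hβ | hβ
  · rcases lt_or_ge α 0 with hα | hα
    · rw [resInftyCoeff, resZeroCoeff, resNegOneCoeff]
      rcases le_or_gt 0 (α + β + 1) with h | h
      · omega
      · rw [zchoose_of_neg _ h, zchoose_upper_neg β, zchoose_upper_neg α, ← mul_assoc, ← sgn_add,
          zchoose_symm (n := -1 - α - β - 1) (by omega)]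
        have h1 : sgn (-1 - α) = - sgn (α + β + 1 + (-1 - β)) := by
          rw [show α + β + 1 + (-1 - β) = (-1 - α) + (2 * α + 1) by ring, sgn_add,
            sgn_congr (a := 2 * α + 1) (b := 1) ⟨α, by ring⟩, sgn_one]
          ring
        rw [h1, show -1 - α - β - 1 - (-1 - α) = -1 - β by ring,
          show -1 - α - β - 1 = -1 - β - α - 1 by ring]
        ring
    · rw [resInftyCoeff_eq, resZeroCoeff, resNegOneCoeff, zchoose_of_neg β (by omega),
        zchoose_symm hα, show α - (α + β + 1) = -1 - β by ring, zero_add]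
  · rw [resInftyCoeff, resZeroCoeff, resNegOneCoeff, zchoose_of_neg α (by omega),
      zchoose_symm hβ, show β - (α + β + 1) = -1 - α by ring, mul_zero, add_zero]

theorem resInftyCoeff_eq_resZeroCoeff (α : ℤ) {β : ℤ} (hβ : 0 ≤ β) :
    resInftyCoeff α β = resZeroCoeff α β := by
  rw [resInftyCoeff_eq_add, resNegOneCoeff, zchoose_of_neg α (by omega), mul_zero, add_zero]

/-- The residue at `0` under the substitution `z ↦ -z / (1 + z)`, which fixes `0`. -/
theorem resZeroCoeff_substitution (α β : ℤ) :
    resZeroCoeff α β = sgn (α + 1) * resZeroCoeff α (-α - β - 2) := by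
  rw [resZeroCoeff, resZeroCoeff, zchoose_upper_neg,
    sgn_congr (a := -1 - α) (b := α + 1) ⟨-α - 1, by ring⟩]
  congr 2
  ring

/-- The residue at infinity under the substitution `z ↦ -z / (1 + z)`, which exchanges `-1`
and infinity. -/
theorem resInftyCoeff_substitution (α β : ℤ) :
    resInftyCoeff α β = sgn α * resNegOneCoeff α (-α - β - 2) := by
  rw [resInftyCoeff_eq, resNegOneCoeff, ← mul_assoc, ← sgn_add,
    sgn_congr (a := α + (α + (-α - β - 2) + 1)) (b := α + β + 1) ⟨-β - 1, by ring⟩]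
  congr 2
  ring

theorem finsum_choose_mul_resZeroCoeff (p α β : ℤ) :
    ∑ᶠ i : ℕ, Ring.choose p i * resZeroCoeff (α + i) β = resZeroCoeff α (β + p) := by
  rw [resZeroCoeff, ← finsum_choose_mul_zchoose]
  refine finsum_congr fun i => ?_
  rw [resZeroCoeff, sub_sub]

theorem finsum_choose_mul_resInftyCoeff (p α β : ℤ) :
    ∑ᶠ i : ℕ, Ring.choose p i * resInftyCoeff (α + p - i) β = resInftyCoeff α (β + p) := by
  rw [resInftyCoeff, ← finsum_choose_mul_zchoose]
  refine finsum_congr fun i => ?_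
  rw [resInftyCoeff]
  congr 2
  ring

theorem finsum_sign_choose_mul_resInftyCoeff (r α β : ℤ) :
    ∑ᶠ i : ℕ, ((-1) ^ i * Ring.choose r i) * resInftyCoeff α (β + r - i) =
      resInftyCoeff (α + r) β := by
  rw [resInftyCoeff_eq, ← finsum_choose_mul_zchoose,
    ← smul_eq_mul (sgn _), smul_finsum' _ (finite_support_mul_zchoose _ _ _)]
  refine finsum_congr fun i => ?_
  have h : ((-1) ^ i : ℤ) = sgn i := by simp [sgn, Int.coe_negOnePow_natCast]
  rw [resInftyCoeff_eq, h, smul_eq_mul,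
    show α + (β + r - i) + 1 = α + r + β + 1 - i by ring,
    sgn_congr (a := α + r + β + 1) (b := i + (α + r + β + 1 - i)) ⟨0, by ring⟩, sgn_add]
  ring

theorem finsum_sign_choose_mul_resNegOneCoeff (r α β : ℤ) :
    ∑ᶠ i : ℕ, (sgn (r + i) * Ring.choose r i) * resNegOneCoeff α (β + i) =
      resNegOneCoeff (α + r) β := by
  rw [resNegOneCoeff, ← finsum_choose_mul_zchoose,
    ← smul_eq_mul (sgn _), smul_finsum' _ (finite_support_mul_zchoose _ _ _)]
  refine finsum_congr fun i => ?_
  rw [resNegOneCoeff, smul_eq_mul,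
    sgn_congr (a := α + r + β + 1) (b := (r + i) + (α + (β + i) + 1)) ⟨-i, by ring⟩,
    sgn_add (r + i), sub_sub]
  ring

/-! ### Residues of vector-valued rational functions -/

section Pairing

variable {W : Type*} [AddCommGroup W]

/-- Formal combinations `∑ z^α (1 + z)^β w`, with coefficients `w ∈ W`: a presentation of
the elements of `W ⊗ ℤ[z^±1, (1 + z)^±1]`. -/
abbrev RationalForm (W : Type*) [AddCommGroup W] := (ℤ × ℤ) →₀ W

/-- The additive functional sending `z^α (1 + z)^β w` to `K α β • w`. -/
noncomputable def pairing (K : ℤ → ℤ → ℤ) : RationalForm W →+ W :=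
  Finsupp.liftAddHom fun x => DistribSMul.toAddMonoidHom W (K x.1 x.2)

theorem pairing_apply (K : ℤ → ℤ → ℤ) (F : RationalForm W) :
    pairing K F = ∑ x ∈ F.support, K x.1 x.2 • F x := by
  simp [pairing, Finsupp.liftAddHom_apply, Finsupp.sum]

@[simp]
theorem pairing_single (K : ℤ → ℤ → ℤ) (α β : ℤ) (w : W) :
    pairing K (Finsupp.single (α, β) w) = K α β • w := by
  simp [pairing]

theorem finsum_smul_pairing (c : ℕ → ℤ) (K : ℕ → ℤ → ℤ → ℤ) (K' : ℤ → ℤ → ℤ)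
    (hfin : ∀ α β, (Function.support fun i => c i * K i α β).Finite)
    (hsum : ∀ α β, ∑ᶠ i, c i * K i α β = K' α β) (F : RationalForm W) :
    ∑ᶠ i, c i • pairing (K i) F = pairing K' F := by
  simp only [pairing_apply, Finset.smul_sum, smul_smul]
  rw [finsum_sum_comm]
  · refine Finset.sum_congr rfl fun x _ => ?_
    rw [← hsum, finsum_smul' (hfin _ _)]
  · intro x _
    refine (hfin x.1 x.2).subset fun i hi h => hi ?_
    simp only [h, zero_smul]

/-- The residue of `z^m (1 + z)^n F` at `z = 0`. -/
noncomputable def resZero (F : RationalForm W) (m n : ℤ) : W :=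
  pairing (fun α β => resZeroCoeff (α + m) (β + n)) F

/-- Minus the residue of `z^m (1 + z)^n F` at infinity. -/
noncomputable def resInfty (F : RationalForm W) (m n : ℤ) : W :=
  pairing (fun α β => resInftyCoeff (α + m) (β + n)) F

/-- The residue of `z^m (1 + z)^n F` at `z = -1`. -/
noncomputable def resNegOne (F : RationalForm W) (m n : ℤ) : W :=
  pairing (fun α β => resNegOneCoeff (α + m) (β + n)) F

/-- The residue theorem. -/
theorem resInfty_eq_add (F : RationalForm W) (m n : ℤ) :
    resInfty F m n = resZero F m n + resNegOne F m n := by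
  simp only [resInfty, resZero, resNegOne, pairing_apply, ← Finset.sum_add_distrib,
    resInftyCoeff_eq_add, add_smul]

theorem finsum_choose_smul_resZero (F : RationalForm W) (p m n : ℤ) :
    ∑ᶠ i : ℕ, Ring.choose p i • resZero F (m + i) n = resZero F m (n + p) := by
  refine finsum_smul_pairing _ _ _ (fun α β => ?_) (fun α β => ?_) F
  · refine (finite_support_mul_zchoose (Ring.choose p) (fun _ => β + n) (-1 - (α + m))).subset
      (subset_of_eq ?_)
    simp only [resZeroCoeff, sub_sub, add_assoc]
  · simp only [← add_assoc, finsum_choose_mul_resZeroCoeff]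

theorem finsum_choose_smul_resInfty (F : RationalForm W) (p m n : ℤ) :
    ∑ᶠ i : ℕ, Ring.choose p i • resInfty F (m + p - i) n = resInfty F m (n + p) := by
  refine finsum_smul_pairing _ _ _ (fun α β => ?_) (fun α β => ?_) F
  · refine (finite_support_mul_zchoose (Ring.choose p) (fun _ => β + n)
      (α + m + p + (β + n) + 1)).subset (subset_of_eq ?_)
    simp only [resInftyCoeff]
    congr! 4
    ring
  · simp only [← add_assoc, ← add_sub_assoc, finsum_choose_mul_resInftyCoeff]

theorem finsum_sign_choose_smul_resInfty (F : RationalForm W) (r m n : ℤ) :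
    ∑ᶠ i : ℕ, ((-1) ^ i * Ring.choose r i) • resInfty F m (n + r - i) = resInfty F (m + r) n := by
  refine finsum_smul_pairing _ _ _ (fun α β => ?_) (fun α β => ?_) F
  · refine (finite_support_mul_zchoose (fun i => (-1) ^ i * Ring.choose r i)
      (fun i => β + (n + r - i)) (α + m + r + (β + n) + 1)).subset (subset_of_eq ?_)
    simp only [resInftyCoeff]
    congr! 4
    ring
  · simp only [← add_assoc, ← add_sub_assoc, finsum_sign_choose_mul_resInftyCoeff]

theorem finsum_sign_choose_smul_resNegOne (F : RationalForm W) (r m n : ℤ) :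
    ∑ᶠ i : ℕ, (sgn (r + i) * Ring.choose r i) • resNegOne F m (n + i) =
      resNegOne F (m + r) n := by
  refine finsum_smul_pairing _ _ _ (fun α β => ?_) (fun α β => ?_) F
  · refine (finite_support_mul_zchoose
      (fun i => sgn (r + i) * Ring.choose r i * sgn (α + m + (β + (n + i)) + 1))
      (fun _ => α + m) (-1 - (β + n))).subset (subset_of_eq ?_)
    simp only [resNegOneCoeff, mul_assoc, sub_sub, add_assoc]
  · simp only [← add_assoc, finsum_sign_choose_mul_resNegOneCoeff]

/-- A rational function with no pole at `-1` has the same residues at `0` and (up to sign) at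
infinity. Multiplication by a high power of `1 + z` always leads to this case. -/
theorem exists_resZero_eq_resInfty (F : RationalForm W) :
    ∃ L : ℤ, ∀ m, resZero F m L = resInfty F m L := by
  obtain ⟨B, hB⟩ := (F.support.image Prod.snd).finite_toSet.bddBelow
  refine ⟨-B, fun m => ?_⟩
  simp only [resZero, resInfty, pairing_apply]
  refine Finset.sum_congr rfl fun x hx => ?_
  have : B ≤ x.2 := hB (by simpa using ⟨x.1, by simpa using hx⟩)
  rw [resInftyCoeff_eq_resZeroCoeff _ (by omega)]

/-- The expansion at `z = 0` determines the expansion at infinity. -/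
theorem resInfty_eq_zero_of_resZero (F : RationalForm W) (h : ∀ j, resZero F j 0 = 0) (m n : ℤ) :
    resInfty F m n = 0 := by
  obtain ⟨L, hL⟩ := exists_resZero_eq_resInfty F
  have h0 : ∀ m n, resZero F m n = 0 := fun m n => by
    rw [← zero_add n, ← finsum_choose_smul_resZero]
    simp only [h, smul_zero, finsum_zero]
  rw [show n = L + (n - L) by ring, ← finsum_choose_smul_resInfty]
  simp only [← hL, h0, smul_zero, finsum_zero]

/-- The expansion at infinity determines the expansion at `z = 0`. -/
theorem resZero_eq_zero_of_resInfty (F : RationalForm W) (h : ∀ p, resInfty F 0 p = 0) (m n : ℤ) :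
    resZero F m n = 0 := by
  obtain ⟨L, hL⟩ := exists_resZero_eq_resInfty F
  have h0 : ∀ m n, resInfty F m n = 0 := fun m n => by
    rw [← zero_add m, ← finsum_sign_choose_smul_resInfty]
    simp only [h, smul_zero, finsum_zero]
  rw [show n = L + (n - L) by ring, ← finsum_choose_smul_resZero]
  simp only [hL, h0, smul_zero, finsum_zero]

theorem resInfty_congr {F G : RationalForm W} (h : ∀ j, resZero F j 0 = resZero G j 0) (m n : ℤ) :
    resInfty F m n = resInfty G m n := by
  refine sub_eq_zero.1 ?_
  rw [resInfty, resInfty, ← map_sub]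
  refine resInfty_eq_zero_of_resZero (F - G) (fun j => ?_) m n
  rw [resZero, map_sub]
  exact sub_eq_zero.2 (h j)

theorem resZero_congr {F G : RationalForm W} (h : ∀ p, resInfty F 0 p = resInfty G 0 p) (m n : ℤ) :
    resZero F m n = resZero G m n := by
  refine sub_eq_zero.1 ?_
  rw [resZero, resZero, ← map_sub]
  refine resZero_eq_zero_of_resInfty (F - G) (fun j => ?_) m n
  rw [resInfty, map_sub]
  exact sub_eq_zero.2 (h j)

/-- The pullback of `F dz` along `z ↦ -z / (1 + z)`, multiplied by `-(1 + z)^(-M)`: the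
substitution sends `z^α (1 + z)^β dz` to `-(-1)^α z^α (1 + z)^(-α-β-2) dz`. -/
noncomputable def substitution (M : ℤ) (F : RationalForm W) : RationalForm W :=
  ∑ x ∈ F.support, Finsupp.single (x.1, -x.1 - x.2 - 2 - M) (sgn x.1 • F x)

theorem resZero_substitution (M : ℤ) (F : RationalForm W) (j : ℤ) :
    resZero (substitution M F) j 0 = sgn (j + 1) • resZero F j (M - j) := by
  rw [resZero, resZero, substitution, map_sum, pairing_apply, Finset.smul_sum]
  refine Finset.sum_congr rfl fun x _ => ?_
  rw [pairing_single, smul_smul, smul_smul, mul_comm, resZeroCoeff_substitution (x.1 + j) (x.2 + _),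
    ← mul_assoc, ← sgn_add,
    sgn_congr (a := j + 1 + (x.1 + j + 1)) (b := x.1) ⟨j + 1, by ring⟩]
  congr 3
  ring

theorem resNegOne_substitution (M : ℤ) (F : RationalForm W) (p : ℤ) :
    resNegOne (substitution M F) 0 p = resInfty F 0 (M - p) := by
  rw [resNegOne, resInfty, substitution, map_sum, pairing_apply]
  refine Finset.sum_congr rfl fun x _ => ?_
  rw [pairing_single, smul_smul, resInftyCoeff_substitution, mul_comm, add_zero]
  congr 3
  ring

/-- The combination `(1 + z)^(-l) ∑_{s ∈ S} g(s) z^(-s-1)`. -/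
noncomputable def ofCoeffs (S : Finset ℤ) (l : ℤ) (g : ℤ → W) : RationalForm W :=
  ∑ s ∈ S, Finsupp.single (-s - 1, -l) (g s)

theorem sum_zchoose_smul (S : Finset ℤ) (n : ℤ) (e : ℤ ≃ ℤ) (g : ℤ → W)
    (hg : ∀ s ∉ S, 0 ≤ e s → g s = 0) :
    ∑ s ∈ S, zchoose n (e s) • g s = ∑ᶠ i : ℕ, Ring.choose n i • g (e.symm i) := by
  have h1 : ∑ s ∈ S, zchoose n (e s) • g s = ∑ᶠ s, zchoose n (e s) • g s := by
    refine (finsum_eq_sum_of_support_subset _ fun s hs => ?_).symm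
    by_contra h
    rcases lt_or_ge (e s) 0 with h' | h'
    · exact hs (by simp only [zchoose_of_neg _ h', zero_smul])
    · exact hs (by simp only [hg s h h', smul_zero])
  rw [h1, ← finsum_comp_equiv e.symm, ← finsum_mem_univ,
    ← finsum_mem_inter_support_eq (s := Set.range ((↑) : ℕ → ℤ)),
    finsum_mem_range Nat.cast_injective]
  · simp [zchoose_natCast]
  · ext k
    simp only [Set.mem_inter_iff, Set.mem_range, Set.mem_univ, true_and, and_iff_right_iff_imp]
    intro hk
    refine ⟨k.toNat, Int.toNat_of_nonneg ?_⟩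
    by_contra h
    exact hk (by simp [zchoose_of_neg _ (not_le.1 h)])

theorem resZero_ofCoeffs (S : Finset ℤ) (l : ℤ) (g : ℤ → W) (m n : ℤ)
    (hg : ∀ s ∉ S, m ≤ s → g s = 0) :
    resZero (ofCoeffs S l g) m n = ∑ᶠ i : ℕ, Ring.choose (n - l) i • g (m + i) := by
  have := sum_zchoose_smul S (n - l) (Equiv.subRight m) g
    (fun s hs h => hg s hs (by simpa using h))
  simp only [Equiv.subRight_apply, Equiv.subRight_symm_apply, add_comm _ m] at this
  rw [← this, resZero, ofCoeffs, map_sum]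
  refine Finset.sum_congr rfl fun s _ => ?_
  rw [pairing_single, resZeroCoeff]
  congr 2 <;> ring

theorem resInfty_ofCoeffs (S : Finset ℤ) (l : ℤ) (g : ℤ → W) (p : ℤ)
    (hg : ∀ s ∉ S, s ≤ p - l → g s = 0) :
    resInfty (ofCoeffs S l g) 0 p = ∑ᶠ i : ℕ, Ring.choose (p - l) i • g (p - l - i) := by
  have := sum_zchoose_smul S (p - l) (Equiv.subLeft (p - l)) g
    (fun s hs h => hg s hs (by simpa using h))
  simp only [Equiv.subLeft_apply, Equiv.subLeft_symm_apply, neg_add_eq_sub] at this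
  rw [← this, resInfty, ofCoeffs, map_sum]
  refine Finset.sum_congr rfl fun s _ => ?_
  rw [pairing_single, resInftyCoeff]
  congr 2 <;> ring

end Pairing

/-! ### Products and iterates as expansions of one rational function -/

theorem hasFiniteSupport_smul {G : Type*} [AddCommGroup G] (c : ℕ → ℤ) (f : ℕ → G) (N : ℤ)
    (h : ∀ i : ℕ, N ≤ i → f i = 0) : Function.HasFiniteSupport fun i => c i • f i := by
  refine (Set.finite_Iio N.toNat).subset fun i hi => ?_
  by_contra hN
  simp only [Set.mem_Iio] at hN
  exact hi (by simp only [h i (by omega), smul_zero])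

section Association

variable {V W : Type*} [AddCommGroup V] [Module ℂ V] [AddCommGroup W] [Module ℂ W]

theorem exists_mode_eq_zero (Y : VertexMap V W) (u : V) (w : W) :
    ∃ N : ℤ, ∀ n, N ≤ n → mode Y u n w = 0 :=
  ⟨-((HahnModule.of ℂ).symm (Y u w)).order, fun n hn =>
    VertexOperator.ncoeff_eq_zero_of_lt_order (Y u) n w (by omega)⟩

theorem mode_vac {vac : V} {Y : VertexMap V W} (h : VacuumProperty vac Y) (n : ℤ) (w : W) :
    mode Y vac n w = if n = -1 then w else 0 := by
  rw [mode, VertexOperator.ncoeff_apply, HVertexOperator.coeff_apply_apply, h w]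
  rw [Equiv.symm_apply_apply]
  split_ifs with hn
  · subst hn
    exact HahnSeries.coeff_single_same _ _
  · exact HahnSeries.coeff_single_of_ne (by omega)

@[simp]
theorem mode_zero_left (Y : VertexMap V W) (n : ℤ) (w : W) : mode Y 0 n w = 0 := by
  simp [mode]

/-- The modes `u_p v_q w` and `(u_j v)_m w` of total index `M = p + q = j + m` are the
coefficients, at infinity and at `0`, of one rational function `F` of `z = x₀ / x₂` with poles at
`0`, `-1` and infinity only. -/
def WeaklyAssociative (Y : VertexMap V V) (YW : VertexMap V W) (M : ℤ) (u v : V) (w : W) : Prop :=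
  ∃ F : RationalForm W,
    (∀ p, mode YW u p (mode YW v (M - p) w) = resInfty F 0 p) ∧
    ∀ j, mode YW (mode Y u j v) (M - j) w = resZero F j 0

theorem WeaklyAssociative.zero (Y : VertexMap V V) (YW : VertexMap V W) (M : ℤ) {u v : V} {w : W}
    (h : u = 0 ∨ v = 0 ∨ w = 0) : WeaklyAssociative Y YW M u v w := by
  refine ⟨0, fun p => ?_, fun j => ?_⟩
  · rw [resInfty, map_zero]
    rcases h with rfl | rfl | rfl <;> simp [mode]
  · rw [resZero, map_zero]
    rcases h with rfl | rfl | rfl <;> simp [mode]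

/-- Additivity in each of the three arguments; the three alternatives of `hadd` say which one
varies. -/
theorem WeaklyAssociative.add {Y : VertexMap V V} {YW : VertexMap V W} {M : ℤ}
    {u v u' v' u'' v'' : V} {w w' w'' : W}
    (h : WeaklyAssociative Y YW M u v w) (h' : WeaklyAssociative Y YW M u' v' w')
    (hadd : (u'' = u + u' ∧ v = v' ∧ v'' = v ∧ w = w' ∧ w'' = w) ∨
      (u = u' ∧ u'' = u ∧ v'' = v + v' ∧ w = w' ∧ w'' = w) ∨
      (u = u' ∧ u'' = u ∧ v = v' ∧ v'' = v ∧ w'' = w + w')) :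
    WeaklyAssociative Y YW M u'' v'' w'' := by
  obtain ⟨F, h1, h2⟩ := h
  obtain ⟨F', h1', h2'⟩ := h'
  refine ⟨F + F', fun p => ?_, fun j => ?_⟩
  · have e := h1 p
    have e' := h1' p
    rw [resInfty] at e e' ⊢
    rw [map_add, ← e, ← e']
    rcases hadd with ⟨rfl, rfl, rfl, rfl, rfl⟩ | ⟨rfl, rfl, rfl, rfl, rfl⟩ |
      ⟨rfl, rfl, rfl, rfl, rfl⟩ <;> simp [mode]
  · have e := h2 j
    have e' := h2' j
    rw [resZero] at e e' ⊢
    rw [map_add, ← e, ← e']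
    rcases hadd with ⟨rfl, rfl, rfl, rfl, rfl⟩ | ⟨rfl, rfl, rfl, rfl, rfl⟩ |
      ⟨rfl, rfl, rfl, rfl, rfl⟩ <;> simp [mode]

theorem WeaklyAssociative.of_homogeneous {ι κ : Type*} {Y : VertexMap V V} {YW : VertexMap V W}
    {M : ℤ} {gV : ι → Submodule ℂ V} {gW : κ → Submodule ℂ W} (hV : iSup gV = ⊤) (hW : iSup gW = ⊤)
    (h : ∀ a b d u v w, u ∈ gV a → v ∈ gV b → w ∈ gW d → WeaklyAssociative Y YW M u v w)
    (u v : V) (w : W) : WeaklyAssociative Y YW M u v w := by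
  induction hV ▸ Submodule.mem_top (x := u) using Submodule.iSup_induction' with
  | zero => exact .zero _ _ _ (.inl rfl)
  | add u u' _ _ hu hu' => exact hu.add hu' (.inl ⟨rfl, rfl, rfl, rfl, rfl⟩)
  | mem a u hu =>
    induction hV ▸ Submodule.mem_top (x := v) using Submodule.iSup_induction' with
    | zero => exact .zero _ _ _ (.inr (.inl rfl))
    | add v v' _ _ hv hv' => exact hv.add hv' (.inr (.inl ⟨rfl, rfl, rfl, rfl, rfl⟩))
    | mem b v hv =>
      induction hW ▸ Submodule.mem_top (x := w) using Submodule.iSup_induction' with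
      | zero => exact .zero _ _ _ (.inr (.inr rfl))
      | add w w' _ _ hw hw' => exact hw.add hw' (.inr (.inr ⟨rfl, rfl, rfl, rfl, rfl⟩))
      | mem d w hw => exact h a b d u v w hu hv hw

/-- The coefficients of `(x₀ + x₂)^l Y_W(Y(u, x₀)v, x₂)w` in terms of modes. -/
theorem mulAddPow_iterateSeries (Y : VertexMap V V) (YW : VertexMap V W) (u v : V) (w : W)
    (l s t : ℤ) :
    mulAddPow l (iterateSeries Y YW u v w) (-1 - s) (-1 - t) =
      ∑ᶠ i : ℕ, Ring.choose l i • mode YW (mode Y u (s + i) v) (t + l - i) w := by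
  rw [mulAddPow]
  refine finsum_congr fun i => ?_
  rw [iterateSeries, mode, mode, VertexOperator.ncoeff_apply, VertexOperator.ncoeff_apply,
    show -1 - s - (i : ℤ) = -(s + i) - 1 by ring,
    show -1 - t - (l - (i : ℤ)) = -(t + l - i) - 1 by ring]

/-- In total degree `M` the series `(x₀ + x₂)^l Y_W(Y(u, x₀)v, x₂)w` has finitely many
coefficients `g(s)`: truncation of `Y(u, x₀)v` bounds the exponents of `x₀` from below and the
iterate formula bounds those of `x₂`. The required rational function is
`(1 + z)^(-l) ∑ g(s) z^(-s-1)`, whose expansion at infinity is given by the product formula. -/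
theorem WeaklyAssociative.of_residueFormulas {Y : VertexMap V V} {YW : VertexMap V W} (M : ℤ)
    {u v : V} {w : W} {k l : ℤ} (hk : ∀ n : ℤ, k ≤ n → mode YW v n w = 0)
    (hprod : ∀ p q : ℤ, q < k → ProductResidueFormula Y YW u v w k l p q)
    (hiter : ∀ p q i : ℤ, k - q ≤ i → IterateResidueFormula Y YW u v w l p q i) :
    WeaklyAssociative Y YW M u v w := by
  obtain ⟨N, hN⟩ := exists_mode_eq_zero Y u v
  set c : ℤ → W := fun j => mode YW (mode Y u j v) (M - j) w with hc
  set g : ℤ → W := fun s => ∑ᶠ i : ℕ, Ring.choose l i • c (s + i)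
  have hcN : ∀ j, N ≤ j → c j = 0 := fun j hj => by simp [hc, hN j hj, mode]
  have hgN : ∀ s, N ≤ s → g s = 0 := fun s hs => by
    refine (finsum_congr fun i => ?_).trans finsum_zero
    rw [hcN _ (by omega), smul_zero]
  have hG : ∀ s, mulAddPow l (iterateSeries Y YW u v w) (-1 - s) (-1 - (M - l - s)) = g s := by
    intro s
    rw [mulAddPow_iterateSeries]
    refine finsum_congr fun i => ?_
    rw [hc]
    congr 3
    ring
  have hgk : ∀ s, s ≤ M - l - k → g s = 0 := fun s hs => by
    have := hiter (s + l) (M - l - s) 0 (by omega)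
    rw [IterateResidueFormula, res2, mulMonomial] at this
    rw [← hG, ← this]
    congr 1 <;> ring
  refine ⟨ofCoeffs (Finset.Icc (M - l - k) N) l g, fun p => ?_, fun j => ?_⟩
  · rw [resInfty_ofCoeffs]
    · rcases lt_or_ge (M - p) k with hq | hq
      · have := hprod p (M - p) hq
        rw [ProductResidueFormula, res2, res2, mulMonomial, productSeries, mulTruncatedBinomial]
          at this
        rw [mode, mode, VertexOperator.ncoeff_apply, VertexOperator.ncoeff_apply, ← neg_add',
          add_comm p, neg_add', ← neg_add' (M - p), add_comm (M - p), neg_add', this,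
          finsum_eq_sum_of_support_subset (s := Finset.range (k - (M - p)).toNat)]
        · refine Finset.sum_congr rfl fun i _ => ?_
          rw [← hG, mulMonomial]
          congr 2 <;> ring
        · intro i hi
          by_contra h
          simp only [Finset.coe_range, Set.mem_Iio] at h
          exact hi (by simp only [hgk (p - l - i) (by omega), smul_zero])
      · rw [hk _ hq, map_zero]
        refine ((finsum_congr fun i => ?_).trans finsum_zero).symm
        rw [hgk _ (by omega), smul_zero]
    · intro s hs _
      rw [Finset.mem_Icc, not_and_or, not_le, not_le] at hs
      exact hs.elim (fun h => hgk s h.le) (fun h => hgN s h.le)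
  -- From index `j` on, `c` agrees with the expansion at `0` of the Laurent polynomial with
  -- coefficients `c j, ..., c N`; for the latter, multiplication by `(1 + z)^l` can be undone.
  · have hcS : ∀ m, j ≤ m → ∀ s ∉ Finset.Icc j N, m ≤ s → c s = 0 := fun m hm s hs hms =>
      hcN s (by rw [Finset.mem_Icc] at hs; omega)
    have hF : ∀ m n, j ≤ m → resZero (ofCoeffs (Finset.Icc j N) 0 c) m n =
        ∑ᶠ i : ℕ, Ring.choose n i • c (m + i) := fun m n hm => by
      rw [resZero_ofCoeffs _ _ _ _ _ (hcS m hm), sub_zero]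
    have h0 : c j = resZero (ofCoeffs (Finset.Icc j N) 0 c) j 0 := by
      rw [hF j 0 le_rfl, finsum_eq_single _ 0 fun i hi => by
        rw [Ring.choose_zero_pos _ (Nat.pos_of_ne_zero hi), zero_smul]]
      simp
    rw [resZero_ofCoeffs]
    · have h1 := finsum_choose_smul_resZero (ofCoeffs (Finset.Icc j N) 0 c) (0 - l) j l
      rw [add_sub_cancel, ← h0] at h1
      change c j = _
      rw [← h1]
      refine finsum_congr fun i => ?_
      rw [hF (j + i) l (by omega)]
    · intro s hs _
      rw [Finset.mem_Icc, not_and_or, not_le, not_le] at hs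
      exact hs.elim (fun h => hgk s h.le) (fun h => hgN s h.le)

/-- The modes of `e^{xD} a`, where `D^i a / i! = a_{-1-i} 𝟏`: this is
`Y_W(Y(a, x₀)𝟏, x₂) = Y_W(a, x₂ + x₀)`. -/
theorem mode_mode_vac {Y : VertexMap V V} {YW : VertexMap V W} {vac : V}
    (hvac : VacuumProperty vac YW) {a : V} {w : W}
    (h : ∀ M, WeaklyAssociative Y YW M a vac w) (m : ℤ) (i : ℕ) :
    mode YW (mode Y a (-1 - i) vac) m w = ((-1) ^ i * Ring.choose m i) • mode YW a (m - i) w := by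
  obtain ⟨F, h1, h2⟩ := h (m - 1 - i)
  have h3 := h2 (-1 - i)
  rw [show m - 1 - (i : ℤ) - (-1 - i) = m by ring] at h3
  -- `Y_W(a, x₀ + x₂)w`, in the total degree at hand, is a multiple of a power of `x₀ + x₂`
  rw [h3, resZero_congr (G := Finsupp.single (0, i - m - 1) (mode YW a (m - i) w)), resZero,
    pairing_single, resZeroCoeff, show -1 - (0 + (-1 - (i : ℤ))) = i by ring, zchoose_natCast,
    ← zchoose_natCast, zchoose_upper_neg, zchoose_natCast,
    show (i : ℤ) - (i - m - 1 + 0) - 1 = m by ring, sgn, Int.coe_negOnePow_natCast]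
  intro p
  rw [← h1, mode_vac hvac, resInfty, pairing_single, resInftyCoeff]
  split_ifs with hp
  · rw [show p = m - i by omega,
      show (0 : ℤ) + 0 + (i - m - 1 + (m - i)) + 1 = (0 : ℕ) by push_cast; ring, zchoose_natCast]
    simp
  · rw [map_zero]
    rcases lt_or_ge (0 + 0 + (i - m - 1 + p) + 1) 0 with h | h
    · rw [zchoose_of_neg _ h, zero_smul]
    · rw [zchoose_symm (by omega), zchoose_of_neg _ (by omega), zero_smul]

end Association

/-! ### Skew-symmetry and the Jacobi identity -/

section Jacobi

variable {V W : Type*} [AddCommGroup V] [Module ℂ V] [AddCommGroup W] [Module ℂ W]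

/-- Skew-symmetry `Y(u, x)v = e^{xD} Y(v, -x)u`. -/
theorem VertexAlgebra.skew_symmetry (A : VertexAlgebra V) (u v : V) (j : ℤ) :
    mode A.Y u j v =
      ∑ᶠ i : ℕ, sgn (j + i + 1) • mode A.Y (mode A.Y v (j + i) u) (-1 - i) A.vac := by
  have h := A.jacobi v u A.vac (-1) 0 j
  have h1 : ∀ i : ℕ, ((-1 : ℤ) ^ i * Ring.choose j i) •
      mode A.Y v (-1 + j - i) (mode A.Y u (0 + i) A.vac) = 0 := fun i => by
    rw [A.creation_regular u _ (by omega), map_zero, smul_zero]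
  rw [finsum_congr h1, finsum_zero, zero_sub, finsum_eq_single _ 0 fun i hi => by
    rw [A.creation_regular v _ (by omega), map_zero, smul_zero]] at h
  simp only [Nat.cast_zero, add_zero, sub_zero, zero_add, Ring.choose_zero_right, mul_one,
    A.creation_const] at h
  have h2 : mode A.Y u j v = (- sgn j) • (-(sgn j • mode A.Y u j v)) := by
    rw [smul_neg, neg_smul, neg_neg, smul_smul, sgn_mul_self, one_smul]
  obtain ⟨N, hN⟩ := exists_mode_eq_zero A.Y v u
  have hfin : Function.HasFiniteSupport fun i : ℕ => Ring.choose (-1 : ℤ) i •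
      mode A.Y (mode A.Y v (j + i) u) (-1 - i) A.vac :=
    hasFiniteSupport_smul _ _ (N - j) fun i hi => by rw [hN _ (by omega), mode_zero_left]
  rw [h2, h, smul_finsum' _ hfin]
  refine finsum_congr fun i => ?_
  have h3 : Ring.choose (-1 : ℤ) i = sgn i := by
    rw [Ring.choose_neg, show (1 : ℤ) + i - 1 = i by ring, Ring.choose_natCast, Nat.choose_self,
      Units.smul_def]
    simp
  rw [smul_smul, h3, sgn_add, sgn_add, sgn_one, mul_neg_one, neg_mul]

/-- Both products and the iterate come from one rational function. If `F'` presents the product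
`Y_W(v, x₂) Y_W(u, x₁)` and its iterate, then by skew-symmetry the pullback of `F'` presents the
iterate `Y_W(Y(u, x₀)v, x₂)`, and its residues at `-1` are the modes of
`Y_W(v, x₂) Y_W(u, x₁)`. The expansion at `0` determines the other residues, so the pullback also
presents `Y_W(u, x₁) Y_W(v, x₂)`. -/
theorem WeaklyAssociative.exists_rationalForm {A : VertexAlgebra V} {YW : VertexMap V W}
    (hvac : VacuumProperty A.vac YW) (hA : ∀ M u v w, WeaklyAssociative A.Y YW M u v w)
    (M : ℤ) (u v : V) (w : W) :
    ∃ F : RationalForm W,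
      (∀ p, mode YW u p (mode YW v (M - p) w) = resInfty F 0 p) ∧
      (∀ p, mode YW v (M - p) (mode YW u p w) = resNegOne F 0 p) ∧
      ∀ j, mode YW (mode A.Y u j v) (M - j) w = resZero F j 0 := by
  obtain ⟨F, hF1, hF2⟩ := hA M u v w
  obtain ⟨F', hF1', hF2'⟩ := hA M v u w
  have hc : ∀ j, mode YW (mode A.Y u j v) (M - j) w = resZero (substitution M F') j 0 := by
    intro j
    obtain ⟨N, hN⟩ := exists_mode_eq_zero A.Y v u
    let φ : V →+ W :=
      { toFun := fun a => mode YW a (M - j) w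
        map_zero' := by simp [mode]
        map_add' := fun a b => by simp [mode] }
    have hφ : ∀ a, mode YW a (M - j) w = φ a := fun _ => rfl
    have hfin : Function.HasFiniteSupport fun i : ℕ => sgn (j + i + 1) •
        mode A.Y (mode A.Y v (j + i) u) (-1 - i) A.vac :=
      hasFiniteSupport_smul _ _ (N - j) fun i hi => by rw [hN _ (by omega), mode_zero_left]
    have hfin' : Function.HasFiniteSupport fun i : ℕ => Ring.choose (M - j) i •
        resZero F' (j + i) 0 :=
      hasFiniteSupport_smul _ _ (N - j) fun i hi => by
        rw [← hF2', hN _ (by omega), mode_zero_left]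
    have h0 := finsum_choose_smul_resZero F' (M - j) j 0
    rw [zero_add] at h0
    rw [resZero_substitution, ← h0, hφ, A.skew_symmetry, φ.map_finsum hfin, smul_finsum' _ hfin']
    refine finsum_congr fun i => ?_
    rw [map_zsmul, ← hφ, mode_mode_vac hvac (fun M => hA M _ _ _), ← hF2', smul_smul, smul_smul,
      show j + (i : ℤ) + 1 = j + 1 + i by ring, sgn_add (j + 1), ← sub_sub]
    have h : ((-1) ^ i : ℤ) = sgn i := by simp [sgn, Int.coe_negOnePow_natCast]
    rw [h, mul_assoc, ← mul_assoc (sgn i), sgn_mul_self, one_mul]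
  refine ⟨substitution M F', fun p => ?_, fun p => ?_, hc⟩
  · rw [hF1, resInfty_congr fun j => ?_]
    rw [← hF2, hc]
  · rw [resNegOne_substitution, ← hF1', sub_sub_cancel]

/-- The Jacobi identity is the residue theorem for `z^r (1 + z)^p F`. -/
theorem jacobiIdentity_of_weaklyAssociative {A : VertexAlgebra V} {YW : VertexMap V W}
    (hvac : VacuumProperty A.vac YW) (hA : ∀ M u v w, WeaklyAssociative A.Y YW M u v w) :
    JacobiIdentity A.Y YW := by
  intro u v w p q r
  obtain ⟨F, h1, h2, h3⟩ := WeaklyAssociative.exists_rationalForm hvac hA (p + q + r) u v w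
  have e1 : ∀ i : ℕ, mode YW u (p + r - i) (mode YW v (q + i) w) = resInfty F 0 (p + r - i) :=
    fun i => by rw [← h1]; congr 3; ring
  have e2 : ∀ i : ℕ, mode YW v (q + r - i) (mode YW u (p + i) w) = resNegOne F 0 (p + i) :=
    fun i => by rw [← h2]; congr 2; ring
  have e3 : ∀ i : ℕ, mode YW (mode A.Y u (r + i) v) (p + q - i) w = resZero F (r + i) 0 :=
    fun i => by rw [← h3]; congr 2; ring
  simp only [e1, e2, e3]
  rw [finsum_sign_choose_smul_resInfty, finsum_sign_choose_smul_resNegOne,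
    finsum_choose_smul_resZero, zero_add, zero_add, resInfty_eq_add, add_sub_cancel_right]

end Jacobi

end FormalVOA

theorem theorem3p2 {V W : Type*} [AddCommGroup V] [Module ℂ V] [AddCommGroup W] [Module ℂ W]
    (A : FormalVOA.VertexAlgebra V) (gV : ℤ → Submodule ℂ V) (hV : FormalVOA.IsZGraded A gV)
    (gW : ℕ → Submodule ℂ W) (hW : DirectSum.IsInternal gW)
    (YW : FormalVOA.VertexMap V W)
    (hdeg : FormalVOA.DegreeCompatible gV gW YW)
    (hvac : FormalVOA.VacuumProperty A.vac YW)
    (hres : ∀ (a b : ℤ) (d : ℕ) (u v : V) (w : W), u ∈ gV a → v ∈ gV b → w ∈ gW d →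
      ∃ k l : ℤ,
        (∀ n : ℤ, k ≤ n → FormalVOA.mode YW v n w = 0) ∧
        (∀ n : ℤ, l ≤ n → FormalVOA.mode YW u n w = 0) ∧
        (∀ p q : ℤ, q < k → FormalVOA.ProductResidueFormula A.Y YW u v w k l p q) ∧
        (∀ p q i : ℤ, k - q ≤ i → FormalVOA.IterateResidueFormula A.Y YW u v w l p q i)) :
    FormalVOA.IsNGradableWeakModule A gV gW YW := by
  refine ⟨⟨hvac, FormalVOA.jacobiIdentity_of_weaklyAssociative hvac fun M u v w => ?_⟩, hW, hdeg⟩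
  refine FormalVOA.WeaklyAssociative.of_homogeneous hV.internal.submodule_iSup_eq_top
    hW.submodule_iSup_eq_top (fun a b d u v w hu hv hw => ?_) u v w
  obtain ⟨k, l, hk, _, hprod, hiter⟩ := hres a b d u v w hu hv hw
  exact .of_residueFormulas M hk hprod hiter
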